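/- Let $\mathcal B$ be a separable complex Banach space, let $p\ge 1$ and $q\ge 0$ be integers, and let $A_1,\dots,A_p$ and $B_0,\dots,B_q$ be continuous linear operators on $\mathcal B$. Let $(Z_t)_{t\in\mathbb Z}$ be an i.i.d. sequence of $\mathcal B$-valued random variables on a probability space. Put $$Q(z)=z^p\,\mathrm{id}-z^{p-1}A_1-\dots-zA_{p-1}-A_p\qquad(z\in\mathbb C)$$ and assume that $Q(z)$ is invertible for all $z\in\mathbb C$ with $|z|=1$. On $\mathcal B^p$, with the maximum norm, let $A$ be the companion operator $$A(x_1,\dots,x_p)=(A_1x_1+\dots+A_px_p,\;x_1,\dots,x_{p-1}),$$ let $\tilde B_k(x_1,\dots,x_p)=(B_kx_1,0,\dots,0)$ for $0\le k\le q$, and let $\tilde Z_t=(Z_t,0,\dots,0)$. A solution of the ARMA($p$,$q$) equation is a $\mathcal B$-valued process $(Y_t)_{t\in\mathbb Z}$ on the same probability space such that, for every $t\in\mathbb Z$, almost surely $$Y_t-A_1Y_{t-1}-\dots-A_pY_{t-p}=B_0Z_t+\dots+B_qZ_{t-q}.$$ It is strictly stationary if for every $h\in\mathbb Z$ the processes $(Y_{t+h})_{t\in\mathbb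 Z}$ and $(Y_t)_{t\in\mathbb Z}$ have the same law. Then: 1. If $$\mathbb E\log^+\Big\|\Big(\sum_{k=0}^q A^{q-k}\tilde B_k\Big)\tilde Z_0\Big\|<\infty,\qquad(*)$$ then the ARMA($p$,$q$) equation has a strictly stationary solution. 2. If $Q(0)$ is also invertible and the ARMA($p$,$q$) equation has a strictly stationary solution, then $(*)$ holds. 3. The strictly stationary solution is unique: if $(Y_t)$ and $(Y'_t)$ are strictly stationary solutions, then $Y_t=Y'_t$ almost surely for every $t\in\mathbb Z$. -/

import Mathlib

open MeasureTheory ProbabilityTheory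

noncomputable section

namespace ARMA

variable {E : Type*} [NormedAddCommGroup E] [NormedSpace ℂ E]

/-- The operator-valued polynomial `Q(z) = z^p id - z^(p-1) A_1 - ⋯ - z A_(p-1) - A_p`.
The operator `A_j` (`1 ≤ j ≤ p`) is stored as `A i` with `i = j - 1`. -/
def Q {p : ℕ} (A : Fin p → E →L[ℂ] E) (z : ℂ) : E →L[ℂ] E :=
  z ^ p • ContinuousLinearMap.id ℂ E - ∑ i : Fin p, z ^ (p - ((i : ℕ) + 1)) • A i

/-- The companion operator on `E^p` (with the maximum norm): the first row of the block matrix is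
`(A_1, …, A_p)`, and row `i + 1` copies the component `i`. -/
def companion {p : ℕ} (A : Fin p → E →L[ℂ] E) : (Fin p → E) →L[ℂ] (Fin p → E) :=
  ContinuousLinearMap.pi fun i =>
    if (i : ℕ) = 0 then ∑ j : Fin p, (A j).comp (ContinuousLinearMap.proj j)
    else ContinuousLinearMap.proj
      (⟨(i : ℕ) - 1, lt_of_le_of_lt (Nat.sub_le _ _) i.isLt⟩ : Fin p)

/-- The operator `(x_1, …, x_p) ↦ (B x_1, 0, …, 0)` on `E^p`. -/
def liftOp (p : ℕ) (B : E →L[ℂ] E) : (Fin p → E) →L[ℂ] (Fin p → E) :=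
  ContinuousLinearMap.pi fun i =>
    if (i : ℕ) = 0 then B.comp (ContinuousLinearMap.proj i) else 0

/-- The vector `(x, 0, …, 0)` of `E^p`. -/
def liftVec (p : ℕ) (x : E) : Fin p → E :=
  fun i => if (i : ℕ) = 0 then x else 0

variable {Ω : Type*} [MeasurableSpace Ω] [MeasurableSpace E]

/-- `Z` is a sequence of independent, identically distributed `E`-valued random variables. -/
structure IsIID (Z : ℤ → Ω → E) (μ : Measure Ω) : Prop where
  measurable : ∀ t, Measurable (Z t)
  indep : iIndepFun Z μ
  identDistrib : ∀ t, IdentDistrib (Z t) (Z 0) μ μ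

/-- `Y` is a strictly stationary process: for every `h`, the shifted process `(Y_{t+h})_t` has the
same law as `(Y_t)_t`, on `ℤ → E` with the product sigma-algebra (that is, they have the same
finite-dimensional distributions). -/
structure IsStrictlyStationary (Y : ℤ → Ω → E) (μ : Measure Ω) : Prop where
  measurable : ∀ t, Measurable (Y t)
  law_shift : ∀ h : ℤ, μ.map (fun ω (t : ℤ) => Y (t + h) ω) = μ.map (fun ω (t : ℤ) => Y t ω)

/-- `Y` solves the ARMA(p,q) equation
`Y_t - A_1 Y_{t-1} - ⋯ - A_p Y_{t-p} = B_0 Z_t + ⋯ + B_q Z_{t-q}` almost surely, for all `t`. -/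
def IsSolution {p q : ℕ} (A : Fin p → E →L[ℂ] E) (B : Fin (q + 1) → E →L[ℂ] E)
    (Z Y : ℤ → Ω → E) (μ : Measure Ω) : Prop :=
  ∀ t : ℤ, ∀ᵐ ω ∂μ,
    Y t ω - ∑ i : Fin p, A i (Y (t - (((i : ℕ) : ℤ) + 1)) ω)
      = ∑ k : Fin (q + 1), B k (Z (t - ((k : ℕ) : ℤ)) ω)

/-- `Y` is a strictly stationary solution of the ARMA(p,q) equation. -/
structure IsStationarySolution {p q : ℕ} (A : Fin p → E →L[ℂ] E) (B : Fin (q + 1) → E →L[ℂ] E)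
    (Z Y : ℤ → Ω → E) (μ : Measure Ω) : Prop where
  stationary : IsStrictlyStationary Y μ
  solution : IsSolution A B Z Y μ

/-- The moment condition `𝔼 log⁺ ‖(∑_{k=0}^q A^{q-k} B̃_k) Z̃_0‖ < ∞`, where `A` is the companion
operator on `E^p`. -/
def LogMoment {p q : ℕ} (A : Fin p → E →L[ℂ] E) (B : Fin (q + 1) → E →L[ℂ] E)
    (Z : ℤ → Ω → E) (μ : Measure Ω) : Prop :=
  ∫⁻ ω, ENNReal.ofReal (Real.posLog
    ‖(∑ k : Fin (q + 1), (companion A ^ (q - (k : ℕ))).comp (liftOp p (B k)))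
      (liftVec p (Z 0 ω))‖) ∂μ < ⊤

end ARMA

end

/-!
# Strictly stationary ARMA processes in Banach spaces

The ARMA equation is equivalent to a first-order recursion `X_t = a X_{t-1} + W_t` for the state
`X_t = (Y_t, …, Y_{t-n})`, order `n + 1`, where `a` is the companion operator and `W_t` the embedded moving
average (`IsSolution.isAR1`, `IsAR1.isSolution`). Subtracting from `X` a finite moving average of
the `Z_{t-i}`, `i < q`, which costs no moments, replaces `W_t` by the i.i.d. sequence
`ζ_t = D Z_{t-q}` with `D = ∑_k a ^ (q - k) B̃_k` (`isAR1_sub_iff`). This `D` is exactly the operator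
in the moment condition, so everything reduces to the recursion `X_t = a X_{t-1} + ζ_t`.

Since `Q(z)` is invertible for `|z| = 1`, the spectrum of `a` misses the unit circle
(`mem_resolventSet_companion`). The Laurent coefficients of the resolvent on that circle then provide
operators `p` and `v_n` commuting with `a`, with `a ^ n v_n = 1 - p`, such that `a ^ n p` and `v_n`
decay exponentially (`exists_isDichotomy`). Solving forward on the stable part and backward on the
unstable part gives, for all `n`,

`p X_t = a ^ n p X_{t-n} + ∑_{j<n} a ^ j p ζ_{t-j}`,
`(1 - p) X_t = v_n X_{t+n} - ∑_{1≤j≤n} v_j ζ_{t+j}`.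

* Uniqueness: the difference of two stationary solutions is bounded in probability and has `ζ = 0`,
  so letting `n → ∞` shows that it vanishes (`IsAR1.ae_eq_zero`).
* Existence: a logarithmic moment makes `‖ζ_t‖` grow subexponentially, so the two series converge
  almost surely (`ae_summable_of_logMoment`), and their difference is a solution (`isAR1_greenSum`).
  It is a fixed measurable functional of the shifted noise, hence stationary.
* Necessity: if a stationary solution exists, the partial sums above are bounded in probability. By
  Ottaviani's inequality and the second Borel–Cantelli lemma, the probabilities
  `P(‖a ^ j p ζ_0‖ > M)` and `P(‖v_j ζ_0‖ > M)` are summable (`exists_tsum_measure_norm_ne_top`). As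
  `p ζ_0` and `(1 - p) ζ_0` are recovered from `a ^ j p ζ_0` and `v_j ζ_0` by operators of at most
  exponential norm, `a` being invertible when `Q(0)` is, this yields the logarithmic moment
  (`IsAR1.logMoment`).
-/

open MeasureTheory ProbabilityTheory

namespace ARMA

/-! ### Exponential dichotomy -/

theorem _root_.ContinuousLinearMap.circleIntegral_comp_comm {F G : Type*}
    [NormedAddCommGroup F] [NormedSpace ℂ F] [CompleteSpace F]
    [NormedAddCommGroup G] [NormedSpace ℂ G] [CompleteSpace G] (L : F →L[ℂ] G) {f : ℂ → F} {c : ℂ}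
    {R : ℝ} (hf : CircleIntegrable f c R) :
    (∮ z in C(c, R), L (f z)) = L (∮ z in C(c, R), f z) := by
  have h := L.intervalIntegral_comp_comm hf.out
  simpa [circleIntegral] using h

section Dichotomy

variable {𝔸 : Type*} [NormedRing 𝔸] [NormedAlgebra ℂ 𝔸]

/-- The Laurent coefficient `(2πi)⁻¹ ∮ z ^ j (z - a)⁻¹ dz` of the resolvent of `a`, with the
integral over the circle of radius `ρ` about the origin. -/
noncomputable def laurent (a : 𝔸) (ρ : ℝ) (j : ℤ) : 𝔸 :=
  (2 * Real.pi * Complex.I : ℂ)⁻¹ • ∮ z in C(0, ρ), z ^ j • resolvent a z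

variable [CompleteSpace 𝔸] {a : 𝔸} {ρ : ℝ}

theorem continuousOn_zpow_smul_resolvent (j : ℤ) :
    ContinuousOn (fun z : ℂ => z ^ j • resolvent a z) (resolventSet ℂ a \ {0}) := by
  intro z hz
  exact ((continuousAt_zpow₀ z j (Or.inl hz.2)).smul
    (spectrum.hasDerivAt_resolvent_const_left hz.1).continuousAt).continuousWithinAt

theorem circleIntegrable_zpow_smul_resolvent (hρ : 0 < ρ)
    (h : Metric.sphere (0 : ℂ) ρ ⊆ resolventSet ℂ a) (j : ℤ) :
    CircleIntegrable (fun z : ℂ => z ^ j • resolvent a z) 0 ρ := by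
  refine ContinuousOn.circleIntegrable hρ.le
    ((continuousOn_zpow_smul_resolvent j).mono fun z hz => ⟨h hz, ?_⟩)
  rintro rfl
  simp [hρ.ne] at hz

theorem laurent_comm (hρ : 0 < ρ) (h : Metric.sphere (0 : ℂ) ρ ⊆ resolventSet ℂ a) (j : ℤ) :
    a * laurent a ρ j = laurent a ρ j * a := by
  have hi := circleIntegrable_zpow_smul_resolvent hρ h j
  have h1 := (ContinuousLinearMap.mul ℂ 𝔸 a).circleIntegral_comp_comm hi
  have h2 := ((ContinuousLinearMap.mul ℂ 𝔸).flip a).circleIntegral_comp_comm hi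
  simp only [ContinuousLinearMap.mul_apply', ContinuousLinearMap.flip_apply] at h1 h2
  rw [laurent, mul_smul_comm, smul_mul_assoc, ← h1, ← h2]
  congr 1
  refine circleIntegral.integral_congr hρ.le fun z hz => ?_
  have hc : Commute a (resolvent a z) := by
    obtain ⟨u, hu⟩ := h hz
    rw [resolvent, ← hu, Ring.inverse_unit]
    refine Commute.units_inv_right ?_
    rw [hu]
    exact Commute.sub_right (Algebra.commutes z a).symm (Commute.refl a)
  simp only [mul_smul_comm, smul_mul_assoc, hc.eq]

/-- The Laurent coefficients solve the recursion `G_{j+1} = a G_j + δ_{j,-1}`: this is the identity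
`z (z - a)⁻¹ = 1 + a (z - a)⁻¹`, integrated against `z ^ j`. -/
theorem laurent_succ (hρ : 0 < ρ) (h : Metric.sphere (0 : ℂ) ρ ⊆ resolventSet ℂ a) (j : ℤ) :
    laurent a ρ (j + 1) = a * laurent a ρ j + if j = -1 then 1 else 0 := by
  have hi := circleIntegrable_zpow_smul_resolvent hρ h j
  have h1 := (ContinuousLinearMap.mul ℂ 𝔸 a).circleIntegral_comp_comm hi
  simp only [ContinuousLinearMap.mul_apply'] at h1
  have hz0 : ∀ z ∈ Metric.sphere (0 : ℂ) ρ, z ≠ 0 := by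
    rintro z hz rfl
    simp [hρ.ne] at hz
  have hzi : CircleIntegrable (fun z : ℂ => z ^ j) 0 ρ :=
    ContinuousOn.circleIntegrable hρ.le fun z hz =>
      (continuousAt_zpow₀ z j (Or.inl (hz0 z hz))).continuousWithinAt
  have h2 : (∮ z in C(0, ρ), z ^ (j + 1) • resolvent a z)
      = (∮ z in C(0, ρ), z ^ j • (1 : 𝔸)) + ∮ z in C(0, ρ), a * z ^ j • resolvent a z := by
    rw [← circleIntegral.integral_add]
    · refine circleIntegral.integral_congr hρ.le fun z hz => ?_
      have hu : (algebraMap ℂ 𝔸 z - a) * resolvent a z = 1 := Ring.mul_inverse_cancel _ (h hz)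
      have : z • resolvent a z = 1 + a * resolvent a z := by
        rw [← hu, sub_mul, sub_add_cancel, Algebra.smul_def]
      simp only [zpow_add_one₀ (hz0 z hz), mul_smul, this, smul_add, mul_smul_comm]
    · exact hzi.smul_continuousOn continuousOn_const
    · exact CircleIntegrable.continuousOn_mul hi (g := fun _ => a) continuousOn_const
  rw [laurent, h2, circleIntegral.integral_smul_const, h1, smul_add, laurent, mul_smul_comm,
    add_comm]
  congr 1
  split_ifs with hj
  · subst hj
    have := circleIntegral.integral_sub_center_inv 0 hρ.ne'
    simp only [sub_zero] at this
    simp only [zpow_neg_one, this, smul_smul]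
    rw [inv_mul_cancel₀ Complex.two_pi_I_ne_zero, one_smul]
  · have := circleIntegral.integral_sub_zpow_of_ne hj 0 0 ρ
    simp only [sub_zero] at this
    simp [this]

/-- The Laurent coefficients do not depend on the circle inside an annulus free of spectrum. -/
theorem laurent_eq_of_annulus {σ : ℝ} (hρ : 0 < ρ) (hle : ρ ≤ σ)
    (h : ∀ z : ℂ, ρ ≤ ‖z‖ → ‖z‖ ≤ σ → z ∈ resolventSet ℂ a) (j : ℤ) :
    laurent a ρ j = laurent a σ j := by
  have key := Complex.circleIntegral_sub_center_inv_smul_eq_of_differentiable_on_annulus_off_countable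
    (c := 0) (f := fun z : ℂ => z ^ (j + 1) • resolvent a z) hρ hle Set.countable_empty ?_ ?_
  · rw [laurent, laurent]
    have hcongr : ∀ τ : ℝ, 0 < τ → (∮ z in C(0, τ), z ^ j • resolvent a z)
        = ∮ z in C(0, τ), (z - 0)⁻¹ • z ^ (j + 1) • resolvent a z := by
      intro τ hτ
      refine circleIntegral.integral_congr hτ.le fun z hz => ?_
      have hz0 : z ≠ 0 := by
        rintro rfl
        simp [hτ.ne] at hz
      simp only [sub_zero, smul_smul]
      rw [zpow_add_one₀ hz0, mul_comm (z ^ j), inv_mul_cancel_left₀ hz0]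
    rw [hcongr ρ hρ, hcongr σ (hρ.trans_le hle), key]
  · refine (continuousOn_zpow_smul_resolvent (j + 1)).mono fun z hz => ?_
    simp only [Set.mem_sdiff, Metric.mem_closedBall, dist_zero_right, Metric.mem_ball, not_lt] at hz
    refine ⟨h z hz.2 hz.1, ?_⟩
    rintro rfl
    simp only [norm_zero] at hz
    linarith [hz.2]
  · intro z hz
    simp only [Set.mem_sdiff, Metric.mem_closedBall, dist_zero_right, Metric.mem_ball, not_le] at hz
    have hz0 : z ≠ 0 := norm_pos_iff.1 (hρ.trans hz.1.2)
    exact (differentiableAt_zpow.2 (Or.inl hz0)).smul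
      (spectrum.hasDerivAt_resolvent_const_left (h z hz.1.2.le hz.1.1.le)).differentiableAt

theorem exists_norm_laurent_le (hρ : 0 < ρ) (h : Metric.sphere (0 : ℂ) ρ ⊆ resolventSet ℂ a) :
    ∃ C, 0 ≤ C ∧ ∀ j : ℤ, ‖laurent a ρ j‖ ≤ C * ρ ^ j := by
  have hc : ContinuousOn (resolvent a) (Metric.sphere (0 : ℂ) ρ) := fun z hz =>
    (spectrum.hasDerivAt_resolvent_const_left (h hz)).continuousAt.continuousWithinAt
  obtain ⟨C, hC⟩ := (isCompact_sphere (0 : ℂ) ρ).exists_bound_of_continuousOn hc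
  refine ⟨ρ * max C 0, by positivity, fun j => ?_⟩
  refine (circleIntegral.norm_two_pi_i_inv_smul_integral_le_of_norm_le_const hρ.le
    (C := ρ ^ j * max C 0) fun z hz => ?_).trans_eq (by ring)
  rw [norm_smul, norm_zpow, mem_sphere_zero_iff_norm.1 hz]
  gcongr
  exact (hC z hz).trans (le_max_left _ _)

/-- Exponential dichotomy of an element `a` of a Banach algebra whose spectrum misses the unit
circle. In terms of the Riesz projection `p` of the part of the spectrum inside the unit disk, the
sequence `a ^ n * p` is the decaying forward half of the Green function, and `v n`, the inverse of
`a ^ n` on the range of `1 - p`, is its decaying backward half. That `p` is idempotent is not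
needed. -/
structure IsDichotomy (a p : 𝔸) (v : ℕ → 𝔸) (C r : ℝ) : Prop where
  comm : Commute a p
  comm_v : ∀ n, Commute a (v n)
  v_zero : v 0 = 1 - p
  mul_v : ∀ n, a * v (n + 1) = v n
  r_pos : 0 < r
  r_lt : r < 1
  norm_p : ∀ n, ‖a ^ n * p‖ ≤ C * r ^ n
  norm_v : ∀ n, ‖v n‖ ≤ C * r ^ n

theorem exists_isDichotomy (h : ∀ z : ℂ, ‖z‖ = 1 → z ∈ resolventSet ℂ a) :
    ∃ p v C r, IsDichotomy a p v C r := by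
  have hsub : Metric.sphere (0 : ℂ) 1 ⊆ resolventSet ℂ a := fun z hz =>
    h z (mem_sphere_zero_iff_norm.1 hz)
  obtain ⟨δ, hδ, hth⟩ := (isCompact_sphere (0 : ℂ) 1).exists_thickening_subset_open
    (spectrum.isOpen_resolventSet a) hsub
  obtain ⟨ε, hε, hεδ, hε1⟩ : ∃ ε, 0 < ε ∧ ε < δ ∧ ε < 1 :=
    ⟨min δ 1 / 2, by positivity, by linarith [min_le_left δ 1, lt_min hδ one_pos],
      by linarith [min_le_right δ 1, lt_min hδ one_pos]⟩
  have hann : ∀ z : ℂ, 1 - ε ≤ ‖z‖ → ‖z‖ ≤ 1 + ε → z ∈ resolventSet ℂ a := by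
    intro z h1 h2
    have hz : 0 < ‖z‖ := by linarith
    refine hth (Metric.mem_thickening_iff.2 ⟨(‖z‖⁻¹ : ℂ) * z, ?_, ?_⟩)
    · simp [hz.ne']
    · have : z - (‖z‖⁻¹ : ℂ) * z = ((‖z‖ - 1 : ℝ) : ℂ) * ((‖z‖⁻¹ : ℂ) * z) := by
        have : (‖z‖ : ℂ) ≠ 0 := by exact_mod_cast hz.ne'
        push_cast
        field_simp
      rw [dist_eq_norm, this, norm_mul, Complex.norm_real, norm_mul, norm_inv, Complex.norm_real,
        norm_norm, inv_mul_cancel₀ hz.ne', mul_one, Real.norm_eq_abs]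
      exact (abs_le.2 ⟨by linarith, by linarith⟩ : |‖z‖ - 1| ≤ ε).trans_lt hεδ
  have hs : ∀ ρ, 1 - ε ≤ ρ → ρ ≤ 1 + ε → Metric.sphere (0 : ℂ) ρ ⊆ resolventSet ℂ a := by
    intro ρ h1 h2 z hz
    rw [mem_sphere_zero_iff_norm] at hz
    exact hann z (hz ▸ h1) (hz ▸ h2)
  have hε' : 0 < 1 - ε := by linarith
  have hs1 := hs (1 - ε) le_rfl (by linarith)
  have hs2 := hs (1 + ε) (by linarith) le_rfl
  -- The inner circle gives the decay of the coefficients of nonnegative index, the outer circle that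
  -- of the coefficients of negative index.
  obtain ⟨C₁, hC₁, hb₁⟩ := exists_norm_laurent_le hε' hs1
  obtain ⟨C₂, hC₂, hb₂⟩ := exists_norm_laurent_le (by linarith : 0 < 1 + ε) hs2
  have heq : ∀ j, laurent a (1 - ε) j = laurent a (1 + ε) j :=
    laurent_eq_of_annulus hε' (by linarith) hann
  set G := laurent a (1 - ε) with hG
  have hcomm : ∀ j, Commute a (G j) := laurent_comm hε' hs1
  have hsucc := laurent_succ hε' hs1
  have hpow : ∀ n : ℕ, a ^ n * G 0 = G n := by
    intro n
    induction n with
    | zero => simp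
    | succ n ih =>
      have := hsucc n
      rw [if_neg (by lia), add_zero, ← hG] at this
      rw [pow_succ', mul_assoc, ih, ← this]
      push_cast
      rfl
  have hr : (1 + ε)⁻¹ < 1 := inv_lt_one_of_one_lt₀ (by linarith)
  refine ⟨G 0, fun n => if n = 0 then 1 - G 0 else -G (-n), C₁ + C₂ + ‖1 - G 0‖,
    max (1 - ε) (1 + ε)⁻¹, hcomm 0, ?_, by simp, ?_, by positivity, by simp [hε, hr], ?_, ?_⟩
  · intro n
    split_ifs
    · exact (Commute.one_right a).sub_right (hcomm 0)
    · exact (hcomm _).neg_right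
  · intro n
    have := hsucc (-(n + 1 : ℕ))
    simp only [Nat.add_eq_zero_iff, one_ne_zero, and_false, if_false, mul_neg]
    rcases Nat.eq_zero_or_pos n with rfl | hn
    · simp only [← hG] at this
      simp at this
      simp [this]
    · rw [if_neg (by lia), add_zero, ← hG] at this
      rw [if_neg hn.ne', ← this]
      congr 2
      push_cast
      ring
  · intro n
    rw [hpow]
    refine (hb₁ n).trans ?_
    rw [zpow_natCast]
    have := norm_nonneg (1 - G 0)
    gcongr
    · linarith
    · exact le_max_left _ _
  · intro n
    split_ifs with hn
    · subst hn
      simp only [pow_zero, mul_one]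
      linarith
    · rw [norm_neg, heq]
      refine (hb₂ _).trans ?_
      rw [zpow_neg, zpow_natCast, ← inv_pow]
      have := norm_nonneg (1 - G 0)
      gcongr
      · linarith
      · exact le_max_right _ _

end Dichotomy

/-! ### The companion operator -/

section Companion

variable {E : Type*} [NormedAddCommGroup E] [NormedSpace ℂ E] {n : ℕ}

theorem companion_apply_zero (A : Fin (n + 1) → E →L[ℂ] E) (x : Fin (n + 1) → E) :
    companion A x 0 = ∑ j, A j (x j) := by
  simp [companion]

theorem companion_apply_succ (A : Fin (n + 1) → E →L[ℂ] E) (x : Fin (n + 1) → E) (i : Fin n) :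
    companion A x i.succ = x i.castSucc := by
  simp only [companion, ContinuousLinearMap.coe_pi', Fin.val_succ, Nat.add_eq_zero_iff,
    one_ne_zero, and_false, if_false, ContinuousLinearMap.proj_apply]
  rfl

theorem Q_apply (A : Fin (n + 1) → E →L[ℂ] E) (z : ℂ) (u : E) :
    Q A z u = z ^ (n + 1) • u - ∑ i : Fin (n + 1), z ^ (n - (i : ℕ)) • A i u := by
  simp [Q]

/-- The vector `(z ^ n u, …, z u, u)`, which solves all the equations of
`(z - companion A) x = 0` but the first. -/
def powVec (n : ℕ) (z : ℂ) (u : E) : Fin (n + 1) → E := fun i => z ^ (n - (i : ℕ)) • u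

theorem smul_powVec_sub_companion (A : Fin (n + 1) → E →L[ℂ] E) (z : ℂ) (u : E) :
    z • powVec n z u - companion A (powVec n z u) = Pi.single 0 (Q A z u) := by
  funext i
  refine Fin.cases ?_ (fun i => ?_) i
  · simp [companion_apply_zero, Q_apply, powVec, pow_succ', smul_smul]
  · have : n - (i : ℕ) = n - (i + 1) + 1 := by lia
    simp [companion_apply_succ, powVec, smul_smul, ← pow_succ', this]

theorem eq_powVec_of_succ (z : ℂ) (x : Fin (n + 1) → E)
    (h : ∀ i : Fin n, x i.castSucc = z • x i.succ) : x = powVec n z (x (Fin.last n)) := by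
  funext i
  induction i using Fin.reverseInduction with
  | last => simp [powVec]
  | cast i ih =>
    have : n - (i : ℕ) = n - (i + 1) + 1 := by lia
    rw [h, ih]
    simp [powVec, smul_smul, ← pow_succ', this]

theorem exists_companion_succ_eq (A : Fin (n + 1) → E →L[ℂ] E) (z : ℂ) (y : Fin (n + 1) → E) :
    ∃ x, ∀ i : Fin n, (z • x - companion A x) i.succ = y i.succ := by
  refine ⟨fun i => Fin.reverseInduction (motive := fun _ => E) 0
    (fun i x => z • x - y i.succ) i, fun i => ?_⟩
  simp [companion_apply_succ]

/-- The companion operator linearizes the polynomial `Q`: eliminating all but the last coordinate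
from `(z - companion A) x = y` leaves an equation `Q(z) u = w`. -/
theorem mem_resolventSet_companion [CompleteSpace E] (A : Fin (n + 1) → E →L[ℂ] E) (z : ℂ)
    (h : IsUnit (Q A z)) : z ∈ resolventSet ℂ (companion A) := by
  rw [ContinuousLinearMap.isUnit_iff_bijective] at h
  have hap : ∀ x, (algebraMap ℂ ((Fin (n + 1) → E) →L[ℂ] (Fin (n + 1) → E)) z - companion A) x
      = z • x - companion A x := fun x => by simp [Algebra.algebraMap_eq_smul_one]
  rw [spectrum.mem_resolventSet_iff, ContinuousLinearMap.isUnit_iff_bijective]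
  constructor
  · refine (injective_iff_map_eq_zero _).2 fun x hx => ?_
    rw [hap] at hx
    have hx' := eq_powVec_of_succ z x fun i => by
      have := congrFun hx i.succ
      simpa [companion_apply_succ, sub_eq_zero, eq_comm] using this
    rw [hx', smul_powVec_sub_companion, Pi.single_eq_zero_iff] at hx
    rw [hx', (injective_iff_map_eq_zero _).1 h.1 _ hx]
    funext i
    simp [powVec]
  · intro y
    obtain ⟨x, hx⟩ := exists_companion_succ_eq A z y
    obtain ⟨u, hu⟩ := h.2 (y 0 - (z • x - companion A x) 0)
    refine ⟨x + powVec n z u, ?_⟩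
    rw [hap, smul_add, map_add, add_sub_add_comm, smul_powVec_sub_companion, hu]
    funext i
    refine Fin.cases ?_ (fun i => ?_) i
    · simp
    · simp only [Pi.add_apply, hx, Pi.single_eq_of_ne (Fin.succ_ne_zero i), add_zero]

theorem isUnit_companion [CompleteSpace E] (A : Fin (n + 1) → E →L[ℂ] E)
    (h : IsUnit (Q A 0)) : IsUnit (companion A) := by
  have := mem_resolventSet_companion A 0 h
  rw [spectrum.mem_resolventSet_iff, map_zero, zero_sub] at this
  exact neg_neg (companion A) ▸ this.neg

end Companion

/-! ### Families bounded in probability -/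

section BoundedInProbability

open scoped ENNReal

variable {Ω ι κ F G : Type*} [MeasurableSpace Ω] {μ : Measure Ω}
  [NormedAddCommGroup F] [NormedAddCommGroup G]

/-- The family `X` is bounded in probability (stochastically bounded), uniformly in the index. -/
def BddInProb (X : ι → Ω → F) (μ : Measure Ω) : Prop :=
  ∀ ε : ℝ≥0∞, ε ≠ 0 → ∃ M : ℝ, 0 ≤ M ∧ ∀ i, μ {ω | M < ‖X i ω‖} ≤ ε

theorem BddInProb.precomp {X : ι → Ω → F} (h : BddInProb X μ) (σ : κ → ι) :
    BddInProb (fun k => X (σ k)) μ := fun ε hε => by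
  obtain ⟨M, hM, hb⟩ := h ε hε
  exact ⟨M, hM, fun k => hb (σ k)⟩

theorem BddInProb.of_norm_le {X : ι → Ω → F} {Y : ι → Ω → G} (h : BddInProb X μ) {K : ℝ}
    (hK : 0 ≤ K) (hle : ∀ i, ∀ᵐ ω ∂μ, ‖Y i ω‖ ≤ K * ‖X i ω‖) : BddInProb Y μ := fun ε hε => by
  obtain ⟨M, hM, hb⟩ := h ε hε
  refine ⟨K * M, by positivity, fun i => (measure_mono_ae ?_).trans (hb i)⟩
  filter_upwards [hle i] with ω hω h1
  exact lt_of_mul_lt_mul_left (lt_of_lt_of_le h1 hω) hK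

theorem BddInProb.congr {X Y : ι → Ω → F} (h : BddInProb X μ) (he : ∀ i, X i =ᵐ[μ] Y i) :
    BddInProb Y μ :=
  h.of_norm_le zero_le_one fun i => (he i).mono fun ω hω => by rw [hω, one_mul]

theorem BddInProb.add {X Y : ι → Ω → F} (hX : BddInProb X μ) (hY : BddInProb Y μ) :
    BddInProb (fun i ω => X i ω + Y i ω) μ := fun ε hε => by
  obtain ⟨M, hM, hb⟩ := hX (ε / 2) (ENNReal.half_pos hε).ne'
  obtain ⟨N, hN, hc⟩ := hY (ε / 2) (ENNReal.half_pos hε).ne'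
  refine ⟨M + N, by positivity, fun i => ?_⟩
  calc μ {ω | M + N < ‖X i ω + Y i ω‖}
      ≤ μ ({ω | M < ‖X i ω‖} ∪ {ω | N < ‖Y i ω‖}) := by
        refine measure_mono fun ω hω => ?_
        by_contra hcon
        simp only [Set.mem_union, Set.mem_ofPred_eq, not_or, not_lt] at hcon hω
        linarith [norm_add_le (X i ω) (Y i ω), hcon.1, hcon.2]
    _ ≤ ε / 2 + ε / 2 := (measure_union_le _ _).trans (add_le_add (hb i) (hc i))
    _ = ε := ENNReal.add_halves ε

theorem BddInProb.neg {X : ι → Ω → F} (h : BddInProb X μ) : BddInProb (fun i ω => -X i ω) μ :=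
  h.of_norm_le zero_le_one fun i => by simp

theorem BddInProb.sub {X Y : ι → Ω → F} (hX : BddInProb X μ) (hY : BddInProb Y μ) :
    BddInProb (fun i ω => X i ω - Y i ω) μ := by
  simpa only [sub_eq_add_neg] using hX.add hY.neg

theorem BddInProb.zero : BddInProb (fun (_ : ι) (_ : Ω) => (0 : F)) μ :=
  fun _ _ => ⟨0, le_rfl, fun _ => by simp⟩

theorem BddInProb.sum {s : Finset κ} {X : κ → ι → Ω → F} (h : ∀ k ∈ s, BddInProb (X k) μ) :
    BddInProb (fun i ω => ∑ k ∈ s, X k i ω) μ := by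
  classical
  induction s using Finset.induction_on with
  | empty => simpa using BddInProb.zero
  | insert k s hk ih =>
    simp only [Finset.sum_insert hk]
    exact (h k (by simp)).add (ih fun l hl => h l (by simp [hl]))

theorem BddInProb.clm [NormedSpace ℂ F] [NormedSpace ℂ G] {X : ι → Ω → F} (h : BddInProb X μ)
    (L : ι → F →L[ℂ] G) {K : ℝ} (hK : ∀ i, ‖L i‖ ≤ K) :
    BddInProb (fun i ω => L i (X i ω)) μ := by
  refine h.of_norm_le (le_max_right K 0) fun i => ae_of_all _ fun ω => ?_
  exact ((L i).le_opNorm _).trans (by gcongr; exact (hK i).trans (le_max_left _ _))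

theorem BddInProb.of_identDistrib [MeasurableSpace F] [OpensMeasurableSpace F] [IsFiniteMeasure μ]
    {X : ι → Ω → F} {i₀ : ι} (h : ∀ i, IdentDistrib (X i) (X i₀) μ μ) : BddInProb X μ := by
  intro ε hε
  have hlim : Filter.Tendsto (fun n : ℕ => μ {ω | (n : ℝ) < ‖X i₀ ω‖}) Filter.atTop (nhds 0) := by
    have hmeas : ∀ n : ℕ, NullMeasurableSet {ω | (n : ℝ) < ‖X i₀ ω‖} μ := fun n =>
      nullMeasurableSet_lt aemeasurable_const (h i₀).aemeasurable_fst.norm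
    have := tendsto_measure_iInter_atTop (μ := μ) hmeas
      (fun m n hmn ω (hω : (n : ℝ) < _) => (lt_of_le_of_lt (Nat.cast_le.2 hmn) hω : (m : ℝ) < _))
      ⟨0, measure_ne_top _ _⟩
    have hempty : ⋂ n : ℕ, {ω | (n : ℝ) < ‖X i₀ ω‖} = ∅ := by
      refine Set.eq_empty_of_forall_notMem fun ω hω => ?_
      obtain ⟨n, hn⟩ := exists_nat_ge ‖X i₀ ω‖
      exact absurd hn (not_le.2 (Set.mem_iInter.1 hω n))
    rwa [hempty, measure_empty] at this
  obtain ⟨n, hn⟩ := (hlim.eventually (gt_mem_nhds (pos_iff_ne_zero.2 hε))).exists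
  refine ⟨n, n.cast_nonneg, fun i => ?_⟩
  have := (h i).measure_mem_eq (s := {x | (n : ℝ) < ‖x‖})
    (measurableSet_lt measurable_const measurable_norm)
  exact (this.trans_lt hn).le

/-- A random vector that is, for every `n`, the image of a stochastically bounded `X n` under an
operator whose norm tends to zero must vanish. -/
theorem ae_eq_zero_of_bddInProb [NormedSpace ℂ F] [NormedSpace ℂ G] {D : Ω → G} {X : ℕ → Ω → F}
    (hX : BddInProb X μ) {L : ℕ → F →L[ℂ] G} (hL : Filter.Tendsto (fun n => ‖L n‖) .atTop (nhds 0))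
    (hD : ∀ n, ∀ᵐ ω ∂μ, D ω = L n (X n ω)) : ∀ᵐ ω ∂μ, D ω = 0 := by
  have key : ∀ k : ℕ, μ {ω | (1 / ((k : ℝ) + 1)) < ‖D ω‖} = 0 := by
    intro k
    refine le_antisymm (le_of_forall_pos_le_add fun ε hε => ?_) zero_le
    rw [zero_add]
    obtain ⟨M, hM, hb⟩ := hX ε hε.ne'
    have hlim : Filter.Tendsto (fun n => ‖L n‖ * M) .atTop (nhds 0) := by
      simpa using hL.mul_const M
    obtain ⟨n, hn⟩ := (hlim.eventually
      (gt_mem_nhds (by positivity : (0 : ℝ) < 1 / ((k : ℝ) + 1)))).exists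
    refine (measure_mono_ae ?_).trans (hb n)
    filter_upwards [hD n] with ω hω (h1 : _ < ‖D ω‖)
    rw [hω] at h1
    have h2 := h1.trans_le ((L n).le_opNorm _)
    exact lt_of_mul_lt_mul_left (hn.trans h2) (norm_nonneg _)
  have : ∀ᵐ ω ∂μ, ∀ k : ℕ, ‖D ω‖ ≤ 1 / ((k : ℝ) + 1) :=
    ae_all_iff.2 fun k => by simpa [ae_iff] using key k
  filter_upwards [this] with ω hω
  exact norm_le_zero_iff.1 (ge_of_tendsto' tendsto_one_div_add_atTop_nhds_zero_nat hω)

end BoundedInProbability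

/-! ### Sums of independent random vectors -/

section Ottaviani

open scoped ENNReal

variable {Ω F : Type*} [NormedAddCommGroup F] [MeasurableSpace F] [BorelSpace F]
  [SecondCountableTopology F]

theorem measurableSet_lt_norm_sum {m : MeasurableSpace Ω} {ξ : ℕ → Ω → F} {s : Finset ℕ}
    (hξ : ∀ i ∈ s, Measurable[m] (ξ i)) (M : ℝ) :
    MeasurableSet[m] {ω | M < ‖∑ i ∈ s, ξ i ω‖} :=
  measurableSet_lt measurable_const (Finset.measurable_fun_sum s hξ).norm

variable [MeasurableSpace Ω] {μ : Measure Ω} [IsProbabilityMeasure μ]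

/-- Ottaviani's maximal inequality, in a qualitative form: if all increments `S n - S k` of the
partial sums of independent random vectors exceed `M` with probability at most `1/4`, then with
positive probability no partial sum exceeds `2M`. -/
theorem measure_iUnion_norm_sum_lt_one {ξ : ℕ → Ω → F} (hm : ∀ i, Measurable (ξ i))
    (hi : iIndepFun ξ μ) {M : ℝ}
    (hM : ∀ k n, k ≤ n → μ {ω | M < ‖∑ i ∈ Finset.Ico k n, ξ i ω‖} ≤ 4⁻¹) :
    μ (⋃ n : ℕ, {ω | 2 * M < ‖∑ i ∈ Finset.range n, ξ i ω‖}) < 1 := by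
  set B : ℕ → Set Ω := fun n => {ω | 2 * M < ‖∑ i ∈ Finset.range n, ξ i ω‖}
  let m : Set ℕ → MeasurableSpace Ω := fun S => ⨆ i ∈ S, MeasurableSpace.comap (ξ i) inferInstance
  have hle : ∀ S, m S ≤ ‹MeasurableSpace Ω› := fun S => iSup₂_le fun i _ => (hm i).comap_le
  have hcoord : ∀ (S : Set ℕ), ∀ i ∈ S, Measurable[m S] (ξ i) := fun S i hi =>
    measurable_iff_comap_le.2 (le_iSup₂_of_le i hi le_rfl)
  have hBm : ∀ k n, k ≤ n → MeasurableSet[m (Set.Iio n)] (B k) := fun k n hk =>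
    measurableSet_lt_norm_sum (fun i hi => hcoord (Set.Iio n) i
      ((Finset.mem_range.1 hi).trans_le hk)) _
  -- The first time at which a partial sum exceeds `2M` is `n` exactly on `disjointed B n`.
  have hAm : ∀ n, MeasurableSet[m (Set.Iio n)] (disjointed B n) := fun n => by
    rw [disjointed_eq_inter_compl]
    exact MeasurableSet.inter (hBm n n le_rfl)
      (MeasurableSet.biInter (Set.to_countable _) fun j hj => (hBm j n (le_of_lt hj)).compl)
  have hsum : ∀ N, ∑ k ∈ Finset.range N, μ (disjointed B k) * (1 - 4⁻¹) ≤ 4⁻¹ := by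
    intro N
    let G : ℕ → Set Ω := fun k => {ω | M < ‖∑ i ∈ Finset.Ico k N, ξ i ω‖}ᶜ
    have hGm : ∀ k, MeasurableSet[m (Set.Ici k)] (G k) := fun k =>
      (measurableSet_lt_norm_sum (fun i hi => hcoord (Set.Ici k) i (Finset.mem_Ico.1 hi).1) _).compl
    have hG : ∀ k < N, 1 - 4⁻¹ ≤ μ (G k) := fun k hk => by
      rw [prob_compl_eq_one_sub (by simpa [G] using (hle _ _ (hGm k)).compl)]
      exact tsub_le_tsub_left (hM k N hk.le) 1
    have hind : ∀ k, μ (disjointed B k ∩ G k) = μ (disjointed B k) * μ (G k) := fun k =>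
      (Indep_iff _ _ _).1 (indep_iSup_of_disjoint (fun i => (hm i).comap_le) hi
        (Set.disjoint_left.2 fun i (h1 : i < k) (h2 : k ≤ i) => absurd h1 (not_lt.2 h2)))
        _ _ (hAm k) (hGm k)
    calc ∑ k ∈ Finset.range N, μ (disjointed B k) * (1 - 4⁻¹)
        ≤ ∑ k ∈ Finset.range N, μ (disjointed B k ∩ G k) := by
          refine Finset.sum_le_sum fun k hk => ?_
          rw [hind]
          gcongr
          exact hG k (Finset.mem_range.1 hk)
      _ = μ (⋃ k ∈ Finset.range N, disjointed B k ∩ G k) := by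
          refine (measure_biUnion_finset ?_ fun k _ =>
            (hle _ _ (hAm k)).inter (hle _ _ (hGm k))).symm
          exact fun i _ j _ hij => ((disjoint_disjointed B) hij).mono
            Set.inter_subset_left Set.inter_subset_left
      _ ≤ μ {ω | M < ‖∑ i ∈ Finset.Ico 0 N, ξ i ω‖} := by
          refine measure_mono (Set.iUnion₂_subset fun k hk ω hω => ?_)
          have h1 : 2 * M < ‖∑ i ∈ Finset.range k, ξ i ω‖ := disjointed_subset B k hω.1
          have h2 : ‖∑ i ∈ Finset.Ico k N, ξ i ω‖ ≤ M := by simpa [G] using hω.2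
          have h3 := Finset.sum_range_add_sum_Ico (fun i => ξ i ω) (Finset.mem_range.1 hk).le
          have h4 := norm_sub_le (∑ i ∈ Finset.range N, ξ i ω) (∑ i ∈ Finset.Ico k N, ξ i ω)
          rw [← h3, add_sub_cancel_right, h3] at h4
          simp only [Finset.range_eq_Ico, Set.mem_ofPred_eq] at h1 h4 ⊢
          linarith
      _ ≤ 4⁻¹ := hM 0 N (Nat.zero_le _)
  have htsum : μ (⋃ n, B n) * (1 - 4⁻¹) ≤ 4⁻¹ := by
    rw [← iUnion_disjointed, measure_iUnion (disjoint_disjointed B) fun n => hle _ _ (hAm n),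
      ← ENNReal.tsum_mul_right]
    exact ENNReal.tsum_le_of_sum_range_le hsum
  by_contra hcon
  have h1 : (1 - 4⁻¹ : ℝ≥0∞) ≤ 4⁻¹ :=
    (by simpa using mul_le_mul_left (not_lt.1 hcon) (1 - 4⁻¹ : ℝ≥0∞) :
      (1 - 4⁻¹ : ℝ≥0∞) ≤ μ (⋃ n, B n) * (1 - 4⁻¹)).trans htsum
  rw [tsub_le_iff_right] at h1
  have h2 := ENNReal.toReal_mono (by finiteness) h1
  rw [ENNReal.toReal_add (by simp) (by simp)] at h2
  norm_num at h2

/-- If the partial sums of independent random vectors are stochastically bounded, then the tail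
probabilities of the summands at some fixed level are summable. Otherwise, by the second
Borel–Cantelli lemma, large summands would occur almost surely, against Ottaviani's inequality. -/
theorem exists_tsum_measure_norm_ne_top {ξ : ℕ → Ω → F} (hm : ∀ i, Measurable (ξ i))
    (hi : iIndepFun ξ μ) (hb : BddInProb (fun n ω => ∑ i ∈ Finset.range n, ξ i ω) μ) :
    ∃ M : ℝ, ∑' j, μ {ω | M < ‖ξ j ω‖} ≠ ∞ := by
  have hincr : BddInProb (fun (x : ℕ × ℕ) ω => ∑ i ∈ Finset.range x.2, ξ i ω
      - ∑ i ∈ Finset.range x.1, ξ i ω) μ := (hb.precomp Prod.snd).sub (hb.precomp Prod.fst)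
  obtain ⟨M, hM, hMb⟩ := hincr 4⁻¹ (by simp)
  have hott := measure_iUnion_norm_sum_lt_one hm hi (M := M) fun k n hk => by
    simpa only [Finset.sum_Ico_eq_sub _ hk] using hMb (k, n)
  refine ⟨4 * M, fun htop => ?_⟩
  have hms : ∀ j, MeasurableSet {ω | 4 * M < ‖ξ j ω‖} := fun j =>
    measurableSet_lt measurable_const (hm j).norm
  have hind : iIndepSet (fun j => {ω | 4 * M < ‖ξ j ω‖}) μ := by
    rw [iIndepSet_iff_meas_biInter hms]
    exact fun s => hi.measure_inter_preimage_eq_mul (sets := fun _ => {x | 4 * M < ‖x‖}) s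
      fun i _ => measurableSet_lt measurable_const measurable_norm
  have hone := measure_limsup_eq_one hms hind htop
  refine (hone.symm.le.trans (measure_mono fun ω hω => ?_)).not_gt hott
  obtain ⟨j, hj⟩ := (Filter.mem_limsup_iff_frequently_mem.1 hω).exists
  have hj' : 4 * M < ‖ξ j ω‖ := hj
  by_contra hcon
  rw [Set.mem_iUnion] at hcon
  simp only [Set.mem_ofPred_eq, not_exists, not_lt] at hcon
  have h1 := norm_sub_le (∑ i ∈ Finset.range (j + 1), ξ i ω) (∑ i ∈ Finset.range j, ξ i ω)
  rw [Finset.sum_range_succ, add_sub_cancel_left, ← Finset.sum_range_succ] at h1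
  linarith [hcon j, hcon (j + 1)]

end Ottaviani

/-! ### Logarithmic moments -/

section LogMoments

open scoped ENNReal

variable {Ω : Type*} [MeasurableSpace Ω] {μ : Measure Ω}

/-- `log⁺ x` is at most `log M` plus `log K` for every `j` with `M * K ^ j < x`: there are at least
`log (x / M) / log K` such `j`. -/
theorem ofReal_posLog_le {K M : ℝ} (hK : 1 < K) (hM : 1 ≤ M) {x : ℝ} (hx : 0 ≤ x) :
    ENNReal.ofReal (Real.posLog x) ≤ ENNReal.ofReal (Real.log M)
      + ∑' j : ℕ, Set.indicator {y | M * K ^ j < y} (fun _ => ENNReal.ofReal (Real.log K)) x := by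
  have hc : 0 < Real.log K := Real.log_pos hK
  have hlM : 0 ≤ Real.log M := Real.log_nonneg hM
  rcases le_or_gt x M with hxM | hxM
  · refine le_add_right (ENNReal.ofReal_le_ofReal ?_)
    rw [← Real.posLog_eq_log (by rwa [abs_of_pos (by linarith)])]
    exact Real.posLog_le_posLog hx hxM
  have hx0 : 0 < x := by linarith
  set m := ⌈(Real.log x - Real.log M) / Real.log K⌉₊
  have hlow : ∀ j ∈ Finset.range m,
      Set.indicator {y | M * K ^ j < y} (fun _ => ENNReal.ofReal (Real.log K)) x
        = ENNReal.ofReal (Real.log K) := by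
    intro j hj
    refine Set.indicator_of_mem ?_ _
    have h1 := Nat.lt_ceil.1 (Finset.mem_range.1 hj)
    rw [lt_div_iff₀ hc] at h1
    have h2 : Real.log (M * K ^ j) < Real.log x := by
      rw [Real.log_mul (by positivity) (by positivity), Real.log_pow]
      linarith
    exact (Real.log_lt_log_iff (by positivity) hx0).1 h2
  calc ENNReal.ofReal (Real.posLog x)
      ≤ ENNReal.ofReal (Real.log M + m * Real.log K) := by
        refine ENNReal.ofReal_le_ofReal ?_
        rw [Real.posLog_eq_log (by rw [abs_of_pos hx0]; linarith)]
        have := (div_le_iff₀ hc).1 (Nat.le_ceil ((Real.log x - Real.log M) / Real.log K))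
        linarith
    _ = ENNReal.ofReal (Real.log M) + ∑ j ∈ Finset.range m,
          Set.indicator {y | M * K ^ j < y} (fun _ => ENNReal.ofReal (Real.log K)) x := by
        rw [Finset.sum_congr rfl hlow, ENNReal.ofReal_add hlM (by positivity),
          ENNReal.ofReal_mul (by positivity)]
        simp
    _ ≤ _ := by gcongr; exact ENNReal.sum_le_tsum _

theorem lintegral_posLog_lt_top [IsFiniteMeasure μ] {X : Ω → ℝ} (hX : Measurable X)
    (h0 : ∀ ω, 0 ≤ X ω) {K M : ℝ} (hK : 1 < K) (hM : 1 ≤ M)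
    (h : ∑' j : ℕ, μ {ω | M * K ^ j < X ω} ≠ ∞) :
    ∫⁻ ω, ENNReal.ofReal (Real.posLog (X ω)) ∂μ < ∞ := by
  have hms : ∀ j : ℕ, MeasurableSet {y : ℝ | M * K ^ j < y} := fun j => measurableSet_Ioi
  have hind : ∀ j : ℕ, Measurable fun ω => Set.indicator {y | M * K ^ j < y}
      (fun _ => ENNReal.ofReal (Real.log K)) (X ω) := fun j =>
    (measurable_const.indicator (hms j)).comp hX
  calc ∫⁻ ω, ENNReal.ofReal (Real.posLog (X ω)) ∂μ
      ≤ ∫⁻ ω, (ENNReal.ofReal (Real.log M) + ∑' j : ℕ,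
          Set.indicator {y | M * K ^ j < y} (fun _ => ENNReal.ofReal (Real.log K)) (X ω)) ∂μ :=
        lintegral_mono fun ω => ofReal_posLog_le hK hM (h0 ω)
    _ = ENNReal.ofReal (Real.log M) * μ Set.univ
          + ∑' j : ℕ, ENNReal.ofReal (Real.log K) * μ {ω | M * K ^ j < X ω} := by
        rw [lintegral_add_left measurable_const, lintegral_const,
          lintegral_tsum fun j => (hind j).aemeasurable]
        congr 2
        funext j
        exact lintegral_indicator_const (hX (hms j)) _
    _ < ∞ := by
        rw [ENNReal.tsum_mul_left]
        exact ENNReal.add_lt_top.2 ⟨by finiteness, ENNReal.mul_lt_top (by simp) h.lt_top⟩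

variable {F G : Type*} [NormedAddCommGroup F] [NormedSpace ℂ F]
  [MeasurableSpace F] [BorelSpace F]
  [NormedAddCommGroup G] [NormedSpace ℂ G]

/-- If `ζ` has a logarithmic moment, then i.i.d. copies of `ζ` grow subexponentially, so that they
can be summed against operators of exponentially decaying norm. -/
theorem ae_summable_of_logMoment [IsProbabilityMeasure μ] [CompleteSpace G]
    {ζ : ℤ → Ω → F} (hid : ∀ t, IdentDistrib (ζ t) (ζ 0) μ μ) (h0 : Measurable (ζ 0))
    (hlog : ∫⁻ ω, ENNReal.ofReal (Real.posLog ‖ζ 0 ω‖) ∂μ < ∞)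
    {L : ℕ → F →L[ℂ] G} {C r : ℝ} (hr0 : 0 < r) (hr1 : r < 1) (hL : ∀ j, ‖L j‖ ≤ C * r ^ j)
    (σ : ℕ → ℤ) : ∀ᵐ ω ∂μ, Summable fun j => L j (ζ (σ j) ω) := by
  -- With `exp c = r ^ (-1/2)`, growth at rate `exp (c j)` is beaten by the decay `r ^ j`.
  set c := -Real.log r / 2 with hc
  have hcpos : 0 < c := by have := Real.log_neg hr0 hr1; linarith
  have hrc : r * Real.exp c < 1 := by
    nth_rw 1 [← Real.exp_log hr0]
    rw [← Real.exp_add, Real.exp_lt_one_iff]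
    have := Real.log_neg hr0 hr1
    linarith
  have hplm : Measurable fun x : F => Real.posLog ‖x‖ / c :=
    (Real.continuous_posLog.measurable.comp measurable_norm).div_const c
  have hint : Integrable (fun ω => Real.posLog ‖ζ 0 ω‖ / c) μ := by
    refine Integrable.div_const ⟨(Real.continuous_posLog.measurable.comp
      h0.norm).aestronglyMeasurable, ?_⟩ c
    exact (hasFiniteIntegral_iff_ofReal (ae_of_all _ fun _ => Real.posLog_nonneg)).2 hlog
  let _ : MeasureSpace Ω := ⟨μ⟩
  have htail := tsum_prob_mem_Ioi_lt_top hint fun ω => div_nonneg Real.posLog_nonneg hcpos.le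
  have htail' : ∑' j : ℕ, μ {ω | (j : ℝ) < Real.posLog ‖ζ (σ j) ω‖ / c} ≠ ∞ := by
    refine (lt_of_eq_of_lt (tsum_congr fun j => ?_) htail).ne
    exact (hid (σ j)).measure_mem_eq (s := {x | (j : ℝ) < Real.posLog ‖x‖ / c})
      (measurableSet_lt measurable_const hplm)
  filter_upwards [ae_eventually_notMem htail'] with ω hω
  refine Summable.of_norm_bounded_eventually_nat
    ((summable_geometric_of_lt_one (by positivity) hrc).mul_left C) ?_
  filter_upwards [hω] with j hj
  simp only [not_lt, div_le_iff₀ hcpos] at hj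
  have hz : ‖ζ (σ j) ω‖ ≤ Real.exp c ^ j := by
    rw [← Real.exp_nat_mul]
    refine (le_max_right 1 _).trans ?_
    rw [← Real.exp_log (lt_max_of_lt_left one_pos : 0 < max 1 ‖ζ (σ j) ω‖),
      ← Real.posLog_eq_log_max_one (norm_nonneg _)]
    exact Real.exp_le_exp.2 hj
  calc ‖L j (ζ (σ j) ω)‖ ≤ ‖L j‖ * ‖ζ (σ j) ω‖ := (L j).le_opNorm _
    _ ≤ (C * r ^ j) * Real.exp c ^ j :=
        mul_le_mul (hL j) hz (norm_nonneg _) ((norm_nonneg _).trans (hL j))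
    _ = C * (r * Real.exp c) ^ j := by rw [mul_pow, mul_assoc]

end LogMoments

open scoped ENNReal

/-! ### Functionals of i.i.d. sequences -/

section IID

variable {Ω E F : Type*} [MeasurableSpace Ω] {μ : Measure Ω} [MeasurableSpace E]
  {Z : ℤ → Ω → E}

theorem IsIID.comp [MeasurableSpace F] (hZ : IsIID Z μ) {f : E → F}
    (hf : Measurable f) (q : ℤ) : IsIID (fun t ω => f (Z (t - q) ω)) μ where
  measurable _ := hf.comp (hZ.measurable _)
  indep := (hZ.indep.precomp (g := fun t => t - q) (sub_left_injective)).comp (fun _ => f)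
    fun _ => hf
  identDistrib t := ((hZ.identDistrib (t - q)).trans (hZ.identDistrib (0 - q)).symm).comp hf

theorem IsIID.map_shift (hZ : IsIID Z μ) (h : ℤ) :
    μ.map (fun ω (t : ℤ) => Z (t + h) ω) = μ.map (fun ω (t : ℤ) => Z t ω) := by
  have := hZ.indep.isProbabilityMeasure
  rw [(hZ.indep.precomp (g := fun t => t + h) (add_left_injective h)).map_fun_eq_infinitePi_map
      fun t => hZ.measurable _, hZ.indep.map_fun_eq_infinitePi_map hZ.measurable]
  congr 1
  funext t
  exact ((hZ.identDistrib (t + h)).trans (hZ.identDistrib t).symm).map_eq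

/-- A process obtained by applying one measurable functional to all shifts of an i.i.d. sequence is
strictly stationary. -/
theorem IsIID.isStrictlyStationary [MeasurableSpace F] (hZ : IsIID Z μ)
    {Φ : (ℤ → E) → F} (hΦ : Measurable Φ) :
    IsStrictlyStationary (fun t ω => Φ fun s => Z (t + s) ω) μ where
  measurable t := hΦ.comp (measurable_pi_iff.2 fun s => hZ.measurable _)
  law_shift h := by
    have hΨ : Measurable fun (z : ℤ → E) (t : ℤ) => Φ fun s => z (t + s) :=
      measurable_pi_iff.2 fun t => hΦ.comp (measurable_pi_iff.2 fun s => measurable_pi_apply _)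
    have h1 : Measurable fun ω (t : ℤ) => Z (t + h) ω := measurable_pi_iff.2 fun t => hZ.measurable _
    have h2 : Measurable fun ω (t : ℤ) => Z t ω := measurable_pi_iff.2 hZ.measurable
    have := congrArg (Measure.map fun (z : ℤ → E) (t : ℤ) => Φ fun s => z (t + s)) (hZ.map_shift h)
    rw [Measure.map_map hΨ h1, Measure.map_map hΨ h2] at this
    simpa only [Function.comp_def, add_right_comm] using this

theorem IsStrictlyStationary.identDistrib {Y : ℤ → Ω → E} (hY : IsStrictlyStationary Y μ) (t : ℤ) :
    IdentDistrib (Y t) (Y 0) μ μ where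
  aemeasurable_fst := (hY.measurable t).aemeasurable
  aemeasurable_snd := (hY.measurable 0).aemeasurable
  map_eq := by
    have := congrArg (Measure.map fun y : ℤ → E => y 0) (hY.law_shift t)
    rw [Measure.map_map (measurable_pi_apply _) (measurable_pi_iff.2 fun s => hY.measurable _),
      Measure.map_map (measurable_pi_apply _) (measurable_pi_iff.2 fun s => hY.measurable _)] at this
    simpa [Function.comp_def] using this

end IID

/-! ### The first-order recursion -/

section Recursion

variable {Ω F : Type*} [MeasurableSpace Ω] {μ : Measure Ω} [NormedAddCommGroup F] [NormedSpace ℂ F]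
  {a p : F →L[ℂ] F} {v : ℕ → F →L[ℂ] F} {C r : ℝ} {X ζ : ℤ → Ω → F}

/-- `X` solves the first-order recursion `X_t = a X_{t-1} + ζ_t` almost surely, for all `t`. -/
def IsAR1 (a : F →L[ℂ] F) (ζ X : ℤ → Ω → F) (μ : Measure Ω) : Prop :=
  ∀ t : ℤ, ∀ᵐ ω ∂μ, X t ω = a (X (t - 1) ω) + ζ t ω

theorem IsAR1.iterate (h : IsAR1 a ζ X μ) (n : ℕ) (t : ℤ) :
    ∀ᵐ ω ∂μ, X t ω = (a ^ n) (X (t - n) ω) + ∑ j ∈ Finset.range n, (a ^ j) (ζ (t - j) ω) := by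
  induction n with
  | zero => simp
  | succ n ih =>
    filter_upwards [ih, h (t - n)] with ω h1 h2
    rw [h1, h2, Finset.sum_range_succ, map_add, pow_succ]
    simp only [Nat.cast_succ, ← sub_sub, mul_apply_eq_comp]
    abel

theorem IsDichotomy.v_mul_pow (h : IsDichotomy a p v C r) (n k : ℕ) :
    v (n + k) * a ^ k = v n := by
  induction k with
  | zero => simp
  | succ k ih => rw [pow_succ', ← mul_assoc, ← add_assoc, ← (h.comm_v _).eq, h.mul_v, ih]

theorem IsDichotomy.pow_mul_v (h : IsDichotomy a p v C r) (n : ℕ) : a ^ n * v n = 1 - p := by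
  rw [← h.v_zero, ← h.v_mul_pow 0 n, zero_add, ((h.comm_v n).pow_left n).eq]

theorem IsDichotomy.tendsto_norm_pow_mul (h : IsDichotomy a p v C r) :
    Filter.Tendsto (fun n => ‖a ^ n * p‖) .atTop (nhds 0) :=
  squeeze_zero (fun _ => norm_nonneg _) h.norm_p (by
    simpa using (tendsto_pow_atTop_nhds_zero_of_lt_one h.r_pos.le h.r_lt).const_mul C)

theorem IsDichotomy.tendsto_norm_v (h : IsDichotomy a p v C r) :
    Filter.Tendsto (fun n => ‖v n‖) .atTop (nhds 0) :=
  squeeze_zero (fun _ => norm_nonneg _) h.norm_v (by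
    simpa using (tendsto_pow_atTop_nhds_zero_of_lt_one h.r_pos.le h.r_lt).const_mul C)

/-- The stable part of a solution, solved forward from time `t - n`. -/
theorem IsAR1.stable (h : IsAR1 a ζ X μ) (hd : IsDichotomy a p v C r) (n : ℕ) (t : ℤ) :
    ∀ᵐ ω ∂μ, p (X t ω) = (a ^ n * p) (X (t - n) ω)
      + ∑ j ∈ Finset.range n, (a ^ j * p) (ζ (t - j) ω) := by
  filter_upwards [h.iterate n t] with ω hω
  rw [hω, map_add, map_sum]
  simp only [(hd.comm.pow_left _).eq, mul_apply_eq_comp]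

/-- The unstable part of a solution, solved backward from time `t + n`. -/
theorem IsAR1.unstable (h : IsAR1 a ζ X μ) (hd : IsDichotomy a p v C r) (n : ℕ) (t : ℤ) :
    ∀ᵐ ω ∂μ, X t ω - p (X t ω) = v n (X (t + n) ω)
      - ∑ j ∈ Finset.range n, v (j + 1) (ζ (t + (j + 1)) ω) := by
  filter_upwards [h.iterate n (t + n)] with ω hω
  have h1 : X t ω - p (X t ω) = (v n * a ^ n) (X t ω) := by
    have := hd.v_mul_pow 0 n
    rw [zero_add] at this
    rw [this, hd.v_zero]
    simp
  rw [h1, hω, map_add, map_sum, add_sub_cancel_right, mul_apply_eq_comp,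
    ← Finset.sum_range_reflect, add_sub_assoc, left_eq_add, sub_eq_zero]
  refine Finset.sum_congr rfl fun j hj => ?_
  have hj' := Finset.mem_range.1 hj
  have h2 := hd.v_mul_pow (j + 1) (n - 1 - j)
  rw [show j + 1 + (n - 1 - j) = n by lia] at h2
  rw [← h2, mul_apply_eq_comp]
  congr 4
  lia

/-- The homogeneous recursion has no nonzero stochastically bounded solution. -/
theorem IsAR1.ae_eq_zero (h : IsAR1 a (fun _ _ => 0) X μ) (hd : IsDichotomy a p v C r)
    (hX : BddInProb X μ) (t : ℤ) : ∀ᵐ ω ∂μ, X t ω = 0 := by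
  have hs : ∀ᵐ ω ∂μ, p (X t ω) = 0 :=
    ae_eq_zero_of_bddInProb (hX.precomp fun n : ℕ => t - n) hd.tendsto_norm_pow_mul fun n => by
      simpa using h.stable hd n t
  have hu : ∀ᵐ ω ∂μ, X t ω - p (X t ω) = 0 :=
    ae_eq_zero_of_bddInProb (hX.precomp fun n : ℕ => t + n) hd.tendsto_norm_v fun n => by
      simpa using h.unstable hd n t
  filter_upwards [hs, hu] with ω h1 h2
  rwa [h1, sub_zero] at h2

theorem norm_pow_le_norm_add_two_pow (x : F →L[ℂ] F) (j : ℕ) : ‖x ^ j‖ ≤ (‖x‖ + 2) ^ j := by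
  induction j with
  | zero => exact ContinuousLinearMap.norm_id_le
  | succ j ih =>
    rw [pow_succ, pow_succ]
    refine (norm_mul_le _ _).trans ?_
    gcongr
    linarith

/-- The stationary solution of the first-order recursion, as a functional of the noise `z` seen from
the current time: `∑_{j ≥ 0} a ^ j p z_{-j} - ∑_{j ≥ 1} v_j z_j`. It is written as a limit of partial
sums, which is measurable in `z` whether or not the series converges. -/
noncomputable def greenSum (a p : F →L[ℂ] F) (v : ℕ → F →L[ℂ] F) (z : ℤ → F) : F :=
  Filter.limUnder Filter.atTop fun n : ℕ =>
    ∑ j ∈ Finset.range n, ((a ^ j * p) (z (-j)) - v (j + 1) (z (j + 1)))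

variable [MeasurableSpace F] [BorelSpace F] [IsProbabilityMeasure μ]

theorem isAR1_greenSum [CompleteSpace F] (hd : IsDichotomy a p v C r) (hζ : IsIID ζ μ)
    (hlog : ∫⁻ ω, ENNReal.ofReal (Real.posLog ‖ζ 0 ω‖) ∂μ < ∞) :
    IsAR1 a ζ (fun t ω => greenSum a p v fun s => ζ (t + s) ω) μ := by
  have hs : ∀ t : ℤ, ∀ᵐ ω ∂μ, Summable fun j : ℕ => (a ^ j * p) (ζ (t + -j) ω) := fun t =>
    ae_summable_of_logMoment hζ.identDistrib (hζ.measurable 0) hlog hd.r_pos hd.r_lt hd.norm_p _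
  have hu : ∀ t : ℤ, ∀ᵐ ω ∂μ, Summable fun j : ℕ => v j (ζ (t + j) ω) := fun t =>
    ae_summable_of_logMoment hζ.identDistrib (hζ.measurable 0) hlog hd.r_pos hd.r_lt hd.norm_v _
  have hval : ∀ t : ℤ, ∀ ω, Summable (fun j : ℕ => (a ^ j * p) (ζ (t + -j) ω)) →
      Summable (fun j : ℕ => v j (ζ (t + j) ω)) → greenSum a p v (fun s => ζ (t + s) ω)
        = ∑' j : ℕ, (a ^ j * p) (ζ (t + -j) ω) - ∑' j : ℕ, v (j + 1) (ζ (t + (j + 1)) ω) := by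
    intro t ω h1 h2
    have h3 := h1.hasSum.sub ((summable_nat_add_iff 1).2 h2).hasSum
    simp only [Nat.cast_add, Nat.cast_one] at h3
    exact h3.tendsto_sum_nat.limUnder_eq
  intro t
  filter_upwards [hs t, hu t, hs (t - 1), hu (t - 1)] with ω h1 h2 h3 h4
  rw [hval t ω h1 h2, hval (t - 1) ω h3 h4, map_sub, a.map_tsum h3, h1.tsum_eq_zero_add,
    a.map_tsum (by simpa using (summable_nat_add_iff 1).2 h4)]
  have h5 : ∀ j : ℕ, a (v (j + 1) (ζ (t - 1 + (j + 1)) ω)) = v j (ζ (t + j) ω) := by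
    intro j
    rw [← hd.mul_v j, mul_apply_eq_comp, show t - 1 + ((j : ℤ) + 1) = t + j by ring]
  have h6 : ∀ j : ℕ, a ((a ^ j * p) (ζ (t - 1 + -j) ω))
      = (a ^ (j + 1) * p) (ζ (t + -(j + 1 : ℕ)) ω) := by
    intro j
    rw [← mul_apply_eq_comp, ← mul_assoc, ← pow_succ',
      show t - 1 + -(j : ℤ) = t + -(j + 1 : ℕ) by push_cast; ring]
  simp only [h5, h6]
  rw [h2.tsum_eq_zero_add, hd.v_zero]
  have h7 : (1 - p) (ζ (t + (0 : ℕ)) ω) = ζ t ω - p (ζ t ω) := by simp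
  rw [h7]
  simp only [pow_zero, one_mul, Nat.cast_zero, neg_zero, add_zero, Nat.cast_succ]
  abel

variable [SecondCountableTopology F]

theorem measurable_greenSum [CompleteSpace F] : Measurable (greenSum a p v) := by
  refine (StronglyMeasurable.limUnder fun n => Measurable.stronglyMeasurable ?_).measurable
  refine Finset.measurable_fun_sum _ fun j _ => ?_
  exact ((a ^ j * p).continuous.measurable.comp (measurable_pi_apply _)).sub
    ((v (j + 1)).continuous.measurable.comp (measurable_pi_apply _))

/-- If the partial sums of the independent vectors `V_j ζ_{σ j}` are stochastically bounded, and
`V_j` can be turned into `L` at an exponential cost, then `L ζ_0` has a logarithmic moment. -/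
theorem logMoment_of_bddInProb_sum (hζ : IsIID ζ μ) {L : F →L[ℂ] F} {U V : ℕ → F →L[ℂ] F} {K : ℝ}
    (hK : 1 < K) (hUV : ∀ j, U j * V j = L) (hU : ∀ j, ‖U j‖ ≤ K ^ (j + 1)) {σ : ℕ → ℤ}
    (hσ : Function.Injective σ)
    (hb : BddInProb (fun n ω => ∑ j ∈ Finset.range n, V j (ζ (σ j) ω)) μ) :
    ∫⁻ ω, ENNReal.ofReal (Real.posLog ‖L (ζ 0 ω)‖) ∂μ < ∞ := by
  obtain ⟨M, hM⟩ := exists_tsum_measure_norm_ne_top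
    (fun j => (V j).continuous.measurable.comp (hζ.measurable (σ j)))
    ((hζ.indep.precomp hσ).comp (fun j => V j) fun j => (V j).continuous.measurable) hb
  refine lintegral_posLog_lt_top (L.continuous.measurable.comp (hζ.measurable 0)).norm
    (fun ω => norm_nonneg _) (M := max M 1 * K) hK
    (one_le_mul_of_one_le_of_one_le (le_max_right _ _) hK.le)
    (ne_top_of_le_ne_top hM (ENNReal.tsum_le_tsum fun j => ?_))
  calc μ {ω | max M 1 * K * K ^ j < ‖L (ζ 0 ω)‖}
      ≤ μ {ω | M < ‖V j (ζ 0 ω)‖} := by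
        refine measure_mono fun ω (hω : max M 1 * K * K ^ j < ‖L (ζ 0 ω)‖) => ?_
        have h1 : ‖L (ζ 0 ω)‖ ≤ K ^ (j + 1) * ‖V j (ζ 0 ω)‖ := by
          rw [← hUV j]
          exact ((U j).le_opNorm _).trans (mul_le_mul_of_nonneg_right (hU j) (norm_nonneg _))
        have h2 : max M 1 < ‖V j (ζ 0 ω)‖ := by
          rw [mul_assoc, ← pow_succ', mul_comm] at hω
          exact lt_of_mul_lt_mul_left (hω.trans_le h1) (by positivity)
        exact (le_max_left _ _).trans_lt h2
    _ = μ {ω | M < ‖V j (ζ (σ j) ω)‖} :=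
        ((hζ.identDistrib (σ j)).measure_mem_eq (s := {x | M < ‖V j x‖})
          (measurableSet_lt measurable_const (V j).continuous.measurable.norm)).symm

/-- A stochastically bounded solution forces a logarithmic moment on the noise. The partial sums
`∑ a ^ j p ζ_{t-j}` and `∑ v_j ζ_{t+j}` are differences of operators of bounded norm applied to the
solution; `a ^ j` can be undone at an exponential cost because `a` is invertible. -/
theorem IsAR1.logMoment (h : IsAR1 a ζ X μ) (hd : IsDichotomy a p v C r) (hX : BddInProb X μ)
    (hζ : IsIID ζ μ) (ha : IsUnit a) : ∫⁻ ω, ENNReal.ofReal (Real.posLog ‖ζ 0 ω‖) ∂μ < ∞ := by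
  have hpow : ∀ n : ℕ, r ^ n ≤ 1 := fun n => pow_le_one₀ hd.r_pos.le hd.r_lt.le
  have hC : 0 ≤ C := by simpa using (norm_nonneg _).trans (hd.norm_v 0)
  have hbd : ∀ n : ℕ, C * r ^ n ≤ C := fun n => mul_le_of_le_one_right hC (hpow n)
  have hs : ∫⁻ ω, ENNReal.ofReal (Real.posLog ‖p (ζ 0 ω)‖) ∂μ < ∞ := by
    obtain ⟨u, rfl⟩ := ha
    refine logMoment_of_bddInProb_sum hζ (U := fun j => (↑u⁻¹ : F →L[ℂ] F) ^ j)
      (V := fun j => (u : F →L[ℂ] F) ^ j * p) (K := ‖(↑u⁻¹ : F →L[ℂ] F)‖ + 2)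
      (by linarith [norm_nonneg (↑u⁻¹ : F →L[ℂ] F)]) (fun j => ?_)
      (fun j => (norm_pow_le_norm_add_two_pow _ _).trans (pow_le_pow_right₀
        (by linarith [norm_nonneg (↑u⁻¹ : F →L[ℂ] F)]) j.le_succ))
      (σ := fun j => 0 - j) (fun i j hij => by simpa using hij) ?_
    · rw [← mul_assoc, ← Units.val_pow_eq_pow_val, ← Units.val_pow_eq_pow_val, ← Units.val_mul,
        inv_pow, inv_mul_cancel, Units.val_one, one_mul]
    · refine BddInProb.congr (((hX.precomp fun _ : ℕ => 0).clm (fun _ => p) (K := ‖p‖)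
        fun _ => le_rfl).sub ((hX.precomp fun n : ℕ => 0 - n).clm
          (fun n => (u : F →L[ℂ] F) ^ n * p) fun n => (hd.norm_p n).trans (hbd n))) fun n => ?_
      filter_upwards [h.stable hd n 0] with ω hω
      rw [hω, add_sub_cancel_left]
  have hu : ∫⁻ ω, ENNReal.ofReal (Real.posLog ‖(1 - p) (ζ 0 ω)‖) ∂μ < ∞ := by
    refine logMoment_of_bddInProb_sum hζ (U := fun j => a ^ (j + 1)) (V := fun j => v (j + 1))
      (K := ‖a‖ + 2) (by linarith [norm_nonneg a]) (fun j => hd.pow_mul_v (j + 1))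
      (fun j => norm_pow_le_norm_add_two_pow _ _) (σ := fun j => 0 + (j + 1))
      (fun i j hij => by simpa using hij) ?_
    refine BddInProb.congr (((hX.precomp fun n : ℕ => 0 + n).clm v
      fun n => (hd.norm_v n).trans (hbd n)).sub ((hX.precomp fun _ : ℕ => 0).clm
        (fun _ => 1 - p) (K := ‖1 - p‖) fun _ => le_rfl)) fun n => ?_
    filter_upwards [h.unstable hd n 0] with ω hω
    have : (1 - p) (X 0 ω) = X 0 ω - p (X 0 ω) := rfl
    rw [this, hω, sub_sub_cancel]
  have hms : Measurable fun ω => ENNReal.ofReal (Real.posLog ‖p (ζ 0 ω)‖) :=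
    (Real.continuous_posLog.measurable.comp
      (p.continuous.measurable.comp (hζ.measurable 0)).norm).ennreal_ofReal
  calc ∫⁻ ω, ENNReal.ofReal (Real.posLog ‖ζ 0 ω‖) ∂μ
      ≤ ∫⁻ ω, (ENNReal.ofReal (Real.posLog ‖p (ζ 0 ω)‖)
          + (ENNReal.ofReal (Real.posLog ‖(1 - p) (ζ 0 ω)‖) + ENNReal.ofReal (Real.log 2))) ∂μ := by
        refine lintegral_mono fun ω => ?_
        rw [← ENNReal.ofReal_add Real.posLog_nonneg (Real.log_nonneg one_le_two),
          ← ENNReal.ofReal_add Real.posLog_nonneg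
            (add_nonneg Real.posLog_nonneg (Real.log_nonneg one_le_two)), ← add_assoc]
        refine ENNReal.ofReal_le_ofReal ((congrArg (fun x => Real.posLog ‖x‖) ?_).trans_le
          (Real.posLog_norm_add_le _ _))
        exact (add_sub_cancel (p (ζ 0 ω)) (ζ 0 ω)).symm
    _ < ∞ := by
        rw [lintegral_add_left hms, lintegral_add_right _ measurable_const, lintegral_const]
        exact ENNReal.add_lt_top.2 ⟨hs, ENNReal.add_lt_top.2 ⟨hu, by finiteness⟩⟩

end Recursion

/-! ### Reduction to i.i.d. noise -/

section NoiseReduction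

variable {Ω E F : Type*} [MeasurableSpace Ω] {μ : Measure Ω}
  [NormedAddCommGroup E] [NormedSpace ℂ E] [NormedAddCommGroup F] [NormedSpace ℂ F]
  {a : F →L[ℂ] F} {b : ℕ → E →L[ℂ] F}

/-- The operators `D_i = ∑_{k ≤ i} a ^ (i - k) b_k`, by Horner's recursion. -/
def horner (a : F →L[ℂ] F) (b : ℕ → E →L[ℂ] F) : ℕ → E →L[ℂ] F
  | 0 => b 0
  | i + 1 => a.comp (horner a b i) + b (i + 1)

theorem horner_eq_sum (i : ℕ) :
    horner a b i = ∑ k ∈ Finset.range (i + 1), (a ^ (i - k)).comp (b k) := by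
  induction i with
  | zero => simp [horner]; rfl
  | succ i ih =>
    rw [horner, ih, Finset.sum_range_succ _ (i + 1), ContinuousLinearMap.comp_finsetSum, Nat.sub_self]
    congr 1
    refine Finset.sum_congr rfl fun k hk => ?_
    rw [Nat.succ_sub (Finset.mem_range_succ_iff.1 hk), pow_succ']
    rfl

/-- The finite moving average `S_t = ∑_{i<q} D_i z_{t-i}` has `S_t - a S_{t-1}` equal to the whole
noise term up to a single contribution, of `z_{t-q}`. -/
theorem sum_horner_sub (z : ℤ → E) (q : ℕ) (t : ℤ) :
    ∑ i ∈ Finset.range q, horner a b i (z (t - i))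
        - a (∑ i ∈ Finset.range q, horner a b i (z (t - 1 - i)))
      = ∑ k ∈ Finset.range (q + 1), b k (z (t - k)) - horner a b q (z (t - q)) := by
  induction q with
  | zero => simp [horner]
  | succ q ih =>
    rw [Finset.sum_range_succ, Finset.sum_range_succ, Finset.sum_range_succ _ (q + 1), map_add,
      add_sub_add_comm, ih, horner]
    simp only [add_apply, ContinuousLinearMap.comp_apply, Nat.cast_succ,
      show t - 1 - (q : ℤ) = t - (q + 1) by ring]
    abel

/-- Subtracting the finite moving average `∑_{i<q} D_i Z_{t-i}` turns the recursion driven by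
`∑_{k≤q} b_k Z_{t-k}` into one driven by the single i.i.d. sequence `D_q Z_{t-q}`. -/
theorem isAR1_sub_iff {Z : ℤ → Ω → E} {X : ℤ → Ω → F} (q : ℕ) :
    IsAR1 a (fun t ω => horner a b q (Z (t - q) ω))
        (fun t ω => X t ω - ∑ i ∈ Finset.range q, horner a b i (Z (t - i) ω)) μ
      ↔ IsAR1 a (fun t ω => ∑ k ∈ Finset.range (q + 1), b k (Z (t - k) ω)) X μ := by
  refine forall_congr' fun t => Filter.eventually_congr (ae_of_all _ fun ω => ?_)
  have := sum_horner_sub (a := a) (b := b) (fun t => Z t ω) q t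
  rw [map_sub, ← sub_eq_zero, ← sub_eq_zero (a := X t ω)]
  have h2 : X t ω - ∑ i ∈ Finset.range q, horner a b i (Z (t - i) ω)
      - (a (X (t - 1) ω) - a (∑ i ∈ Finset.range q, horner a b i (Z (t - 1 - i) ω))
        + horner a b q (Z (t - q) ω))
      = X t ω - (a (X (t - 1) ω) + ∑ k ∈ Finset.range (q + 1), b k (Z (t - k) ω)) := by
    rw [eq_add_of_sub_eq this]
    abel
  rw [h2]

end NoiseReduction

/-! ### The state space equation -/

section StateSpace

variable {Ω E : Type*} [MeasurableSpace Ω] {μ : Measure Ω} [NormedAddCommGroup E] [NormedSpace ℂ E]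
  {n q : ℕ} {A : Fin (n + 1) → E →L[ℂ] E} {B : Fin (q + 1) → E →L[ℂ] E} {Z Y : ℤ → Ω → E}

/-- The coefficients `x ↦ (B_k x, 0, …, 0)` of the noise in the state space equation, extended by
zero to all `k : ℕ`. -/
def stateNoise (n : ℕ) (B : Fin (q + 1) → E →L[ℂ] E) (k : ℕ) : E →L[ℂ] (Fin (n + 1) → E) :=
  if h : k < q + 1 then (ContinuousLinearMap.single ℂ (fun _ => E) 0).comp (B ⟨k, h⟩) else 0

theorem stateNoise_apply (k : Fin (q + 1)) (x : E) :
    stateNoise n B k x = Pi.single 0 (B k x) := by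
  rw [stateNoise, dif_pos k.isLt]
  rfl

theorem sum_stateNoise (z : ℤ → E) (t : ℤ) :
    ∑ k ∈ Finset.range (q + 1), stateNoise n B k (z (t - k))
      = Pi.single 0 (∑ k : Fin (q + 1), B k (z (t - (k : ℕ)))) := by
  rw [Finset.sum_range]
  simp only [stateNoise_apply]
  exact (map_sum (AddMonoidHom.single (fun _ : Fin (n + 1) => E) 0) _ _).symm

theorem horner_stateNoise_apply (x : E) :
    horner (companion A) (stateNoise n B) q x
      = (∑ k : Fin (q + 1), (companion A ^ (q - (k : ℕ))).comp (liftOp (n + 1) (B k)))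
          (liftVec (n + 1) x) := by
  rw [horner_eq_sum, Finset.sum_range, sum_apply, sum_apply]
  refine Finset.sum_congr rfl fun k _ => ?_
  rw [ContinuousLinearMap.comp_apply, ContinuousLinearMap.comp_apply]
  rw [stateNoise_apply]
  congr 1
  funext i
  refine Fin.cases ?_ (fun i => ?_) i <;> simp [liftOp, liftVec]

/-- The state process `(Y_t, Y_{t-1}, …, Y_{t-n})`. -/
def stateProcess (n : ℕ) (Y : ℤ → Ω → E) (t : ℤ) (ω : Ω) : Fin (n + 1) → E :=
  fun i => Y (t - (i : ℕ)) ω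

theorem IsSolution.isAR1 (h : IsSolution A B Z Y μ) :
    IsAR1 (companion A) (fun t ω => ∑ k ∈ Finset.range (q + 1), stateNoise n B k (Z (t - k) ω))
      (stateProcess n Y) μ := by
  intro t
  filter_upwards [h t] with ω hω
  rw [sum_stateNoise fun t => Z t ω]
  funext i
  refine Fin.cases ?_ (fun i => ?_) i
  · rw [Pi.add_apply, companion_apply_zero, Pi.single_eq_same, ← hω]
    simp only [stateProcess, Fin.val_zero, Nat.cast_zero, sub_zero, sub_sub, add_comm (1 : ℤ)]
    abel
  · rw [Pi.add_apply, companion_apply_succ, Pi.single_eq_of_ne (Fin.succ_ne_zero i), add_zero]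
    simp only [stateProcess, Fin.val_succ, Fin.val_castSucc, Nat.cast_succ]
    congr 1
    ring

/-- All coordinates of a solution of the state space equation are delays of the first one, which
therefore solves the ARMA equation. -/
theorem IsAR1.isSolution {X : ℤ → Ω → Fin (n + 1) → E}
    (h : IsAR1 (companion A)
      (fun t ω => ∑ k ∈ Finset.range (q + 1), stateNoise n B k (Z (t - k) ω)) X μ) :
    IsSolution A B Z (fun t ω => X t ω 0) μ := by
  have hall := ae_all_iff.2 h
  intro t
  filter_upwards [hall] with ω hω
  have hcoord : ∀ (i : Fin (n + 1)) (t : ℤ), X t ω i = X (t - (i : ℕ)) ω 0 := by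
    intro i
    induction i using Fin.induction with
    | zero => simp
    | succ i ih =>
      intro t
      rw [hω t, sum_stateNoise fun t => Z t ω, Pi.add_apply, companion_apply_succ,
        Pi.single_eq_of_ne (Fin.succ_ne_zero i), add_zero, ih]
      simp only [Fin.val_succ, Fin.val_castSucc, Nat.cast_succ]
      rw [show t - 1 - ((i : ℕ) : ℤ) = t - ((i : ℕ) + 1) by ring]
  have h0 := congrFun (hω t) 0
  rw [sum_stateNoise fun t => Z t ω, Pi.add_apply, companion_apply_zero, Pi.single_eq_same] at h0
  rw [sub_eq_iff_eq_add, h0, add_comm]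
  congr 1
  refine Finset.sum_congr rfl fun i _ => ?_
  rw [hcoord, sub_sub, add_comm (1 : ℤ)]

theorem BddInProb.stateProcess (h : BddInProb Y μ) : BddInProb (stateProcess n Y) μ := by
  have := BddInProb.sum (s := Finset.univ) fun (i : Fin (n + 1)) _ =>
    (h.precomp fun t : ℤ => t - (i : ℕ)).clm
      (fun _ => ContinuousLinearMap.single ℂ (fun _ => E) i) fun _ => le_rfl
  refine this.congr fun t => ae_of_all _ fun ω => ?_
  exact Finset.univ_sum_single fun i : Fin (n + 1) => Y (t - (i : ℕ)) ω

theorem exists_isDichotomy_companion [CompleteSpace E]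
    (hQ : ∀ z : ℂ, ‖z‖ = 1 → IsUnit (Q A z)) : ∃ p v C r, IsDichotomy (companion A) p v C r :=
  exists_isDichotomy fun z hz => mem_resolventSet_companion A z (hQ z hz)

variable [MeasurableSpace E] [BorelSpace E] [SecondCountableTopology E]

/-- The operator of the moment condition is the last Horner coefficient `D_q` of the state space
equation, and `Z_0` may be replaced by `Z_{-q}`, which has the same law. -/
theorem logMoment_iff (hZ : IsIID Z μ) :
    LogMoment A B Z μ ↔ ∫⁻ ω, ENNReal.ofReal (Real.posLog
      ‖horner (companion A) (stateNoise n B) q (Z (0 - q) ω)‖) ∂μ < ⊤ := by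
  have hm : Measurable fun x : E => ENNReal.ofReal (Real.posLog
      ‖horner (companion A) (stateNoise n B) q x‖) :=
    (Real.continuous_posLog.measurable.comp
      (ContinuousLinearMap.continuous _).measurable.norm).ennreal_ofReal
  have := ((hZ.identDistrib (0 - q)).comp hm).lintegral_eq
  simp only [Function.comp_def] at this
  rw [this, LogMoment]
  simp only [horner_stateNoise_apply]

end StateSpace

/-! ### Stationary solutions of the ARMA equation -/

section StationarySolutions

variable {E : Type*} [NormedAddCommGroup E] [NormedSpace ℂ E] [CompleteSpace E]
  [MeasurableSpace E] [BorelSpace E]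
  {Ω : Type*} [MeasurableSpace Ω] {μ : Measure Ω} [IsProbabilityMeasure μ]
  {n q : ℕ} {B : Fin (q + 1) → E →L[ℂ] E} {Z : ℤ → Ω → E}

/-- The difference of two state processes solves the homogeneous recursion and, each of them being
stationary, is stochastically bounded; no joint stationarity of the two is needed. -/
theorem IsStationarySolution.ae_eq {A : Fin (n + 1) → E →L[ℂ] E} {Y Y' : ℤ → Ω → E}
    (hY : IsStationarySolution A B Z Y μ) (hY' : IsStationarySolution A B Z Y' μ)
    (hQ : ∀ z : ℂ, ‖z‖ = 1 → IsUnit (Q A z)) (t : ℤ) : Y t =ᵐ[μ] Y' t := by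
  obtain ⟨p, v, C, r, hd⟩ := exists_isDichotomy_companion hQ
  have hYb : BddInProb Y μ := BddInProb.of_identDistrib hY.stationary.identDistrib
  have hYb' : BddInProb Y' μ := BddInProb.of_identDistrib hY'.stationary.identDistrib
  have hdiff : IsAR1 (companion A) (fun _ _ => 0)
      (fun t ω => stateProcess n Y t ω - stateProcess n Y' t ω) μ := by
    intro t
    filter_upwards [hY.solution.isAR1 t, hY'.solution.isAR1 t] with ω h1 h2
    rw [h1, h2, map_sub]
    abel
  filter_upwards [hdiff.ae_eq_zero hd (hYb.stateProcess.sub hYb'.stateProcess) t] with ω hω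
  simpa [stateProcess, sub_eq_zero] using congrFun hω 0

variable [SecondCountableTopology E]

theorem exists_isStationarySolution {A : Fin (n + 1) → E →L[ℂ] E} (hZ : IsIID Z μ)
    (hQ : ∀ z : ℂ, ‖z‖ = 1 → IsUnit (Q A z)) (hlog : LogMoment A B Z μ) :
    ∃ Y : ℤ → Ω → E, IsStationarySolution A B Z Y μ := by
  obtain ⟨p, v, C, r, hd⟩ := exists_isDichotomy_companion hQ
  set D := horner (companion A) (stateNoise n B) with hD
  let Φ : (ℤ → E) → Fin (n + 1) → E := fun z =>
    greenSum (companion A) p v (fun s => D q (z (s - q))) + ∑ i ∈ Finset.range q, D i (z (-i))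
  have hDm : ∀ i, Measurable (D i) := fun i => (D i).continuous.measurable
  have hΦ : Measurable Φ :=
    (measurable_greenSum.comp (measurable_pi_iff.2 fun s =>
      (hDm q).comp (measurable_pi_apply _))).add
      (Finset.measurable_fun_sum _ fun i _ => (hDm i).comp (measurable_pi_apply _))
  have hAR := isAR1_greenSum hd (hZ.comp (hDm q) q) ((logMoment_iff hZ).1 hlog)
  refine ⟨fun t ω => Φ (fun s => Z (t + s) ω) 0,
    hZ.isStrictlyStationary ((measurable_pi_apply 0).comp hΦ),
    IsAR1.isSolution (X := fun t ω => Φ fun s => Z (t + s) ω) ((isAR1_sub_iff q).1 ?_)⟩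
  simpa only [Φ, ← hD, ← sub_eq_add_neg, add_sub_cancel_right, add_sub_assoc] using hAR

/-- The reduced process `X_t - ∑_{i<q} D_i Z_{t-i}` need not be stationary, but it is bounded in
probability, which is all that is used. -/
theorem IsStationarySolution.logMoment {A : Fin (n + 1) → E →L[ℂ] E} {Y : ℤ → Ω → E}
    (hY : IsStationarySolution A B Z Y μ) (hZ : IsIID Z μ)
    (hQ : ∀ z : ℂ, ‖z‖ = 1 → IsUnit (Q A z)) (hQ0 : IsUnit (Q A 0)) : LogMoment A B Z μ := by
  obtain ⟨p, v, C, r, hd⟩ := exists_isDichotomy_companion hQ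
  have hZb : BddInProb Z μ := BddInProb.of_identDistrib hZ.identDistrib
  have hYb : BddInProb Y μ := BddInProb.of_identDistrib hY.stationary.identDistrib
  refine (logMoment_iff hZ).2 (((isAR1_sub_iff q).2 hY.solution.isAR1).logMoment hd ?_
    (hZ.comp (ContinuousLinearMap.continuous _).measurable q) (isUnit_companion A hQ0))
  exact hYb.stateProcess.sub
    (BddInProb.sum fun i _ => (hZb.precomp fun t : ℤ => t - i).clm _ fun _ => le_rfl)

end StationarySolutions

end ARMA

theorem theorem2 {E : Type*} [NormedAddCommGroup E] [NormedSpace ℂ E] [CompleteSpace E]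
    [TopologicalSpace.SeparableSpace E] [MeasurableSpace E] [BorelSpace E]
    {Ω : Type*} [MeasurableSpace Ω] (μ : Measure Ω) [IsProbabilityMeasure μ]
    (p q : ℕ) (A : Fin p → E →L[ℂ] E) (B : Fin (q + 1) → E →L[ℂ] E)
    (Z : ℤ → Ω → E) (hZ : ARMA.IsIID Z μ)
    (hQ : ∀ z : ℂ, ‖z‖ = 1 → IsUnit (ARMA.Q A z)) :
    (ARMA.LogMoment A B Z μ → ∃ Y : ℤ → Ω → E, ARMA.IsStationarySolution A B Z Y μ) ∧
    (IsUnit (ARMA.Q A 0) →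
      (∃ Y : ℤ → Ω → E, ARMA.IsStationarySolution A B Z Y μ) → ARMA.LogMoment A B Z μ) ∧
    (∀ Y Y' : ℤ → Ω → E, ARMA.IsStationarySolution A B Z Y μ →
      ARMA.IsStationarySolution A B Z Y' μ → ∀ t : ℤ, Y t =ᵐ[μ] Y' t) := by
  have : SecondCountableTopology E := UniformSpace.secondCountable_of_separable E
  cases p with
  | zero =>
    -- Without an autoregressive part, the moving average is the only solution.
    refine ⟨fun _ => ⟨fun t ω => ∑ k : Fin (q + 1), B k (Z (t + -((k : ℕ) : ℤ)) ω), ?_, ?_⟩, ?_, ?_⟩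
    · exact hZ.isStrictlyStationary (Φ := fun z => ∑ k : Fin (q + 1), B k (z (-((k : ℕ) : ℤ))))
        (Finset.measurable_fun_sum _ fun k _ =>
          (B k).continuous.measurable.comp (measurable_pi_apply _))
    · intro t
      simp [sub_eq_add_neg]
    · intro _ _
      have h0 : ∀ x : Fin 0 → E, ‖x‖ = 0 := fun x => by rw [Subsingleton.elim x 0, norm_zero]
      simp [ARMA.LogMoment, h0]
    · intro Y Y' hY hY' t
      filter_upwards [hY.solution t, hY'.solution t] with ω h1 h2
      simpa using h1.trans h2.symm
  | succ n =>
    exact ⟨ARMA.exists_isStationarySolution hZ hQ,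
      fun hQ0 ⟨Y, hY⟩ => hY.logMoment hZ hQ hQ0,
      fun Y Y' hY hY' t => hY.ae_eq hY' hQ t⟩
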